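/- **Setting.** A 2-out-of-4-SAT instance $\phi$ has $N$ Boolean variables and $M$ clauses; each clause has four literals (possibly negated) on four distinct variables and is satisfied by an assignment iff exactly two of its literals are true. It is $c$-*balanced* if every variable occurs in at most $c$ clauses, and has *gap* $\varepsilon$ if it is either satisfiable or every assignment violates at least $\varepsilon M$ clauses. A *block partition* is a partition of the clauses into $s$ (possibly empty) blocks such that no two different clauses in the same block share a variable. For $x\in\{0,1\}^N$ the *proper state* is $|\psi_x\rangle=\frac1{\sqrt N}\sum_{i=1}^N(-1)^{x_i}|i\rangle$. **Protocol** (for $N$ even). Arthur receives $K$ unentangled states, here all equal to one unit vector $|\varphi\rangle\in\mathbb C^N$, and performs one of two tests, each with probability $1/2$. *Satisfiability Test.* Arthur takes any one copy of $|\varphi\rangle$, picks a uniformly random block, and measures with one projector per clause $C$ of the block (onto the span of the basis states of the four variables of $C$) and one projector onto the orthogonal complement of all of these. On the latter outcome he accepts. On outcome $C=(i,j,k,\ell)$ he measures the reduced state with the projector onto the span of the states $\frac12[(-1)^{x_i}|i\rangle+(-1)^{x_j}|j\rangle+(-1)^{x_k}|k\rangle+(-1)^{x_\ell}|\ell\rangle]$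 over all assignments $x$ satisfying $C$, and accepts iff the state is projected onto that span. *Uniformity Test.* Arthur chooses a perfect matching $\mathcal M$ on $[N]$ uniformly at random and measures each of the $K$ copies in the orthonormal basis $\{(|i\rangle\pm|j\rangle)/\sqrt2:(i,j)\in\mathcal M\}$. He rejects iff for some $(i,j)\in\mathcal M$ both outcomes $(|i\rangle+|j\rangle)/\sqrt2$ and $(|i\rangle-|j\rangle)/\sqrt2$ occur among the $K$ outcomes. **Theorem.** 1. Every $c$-balanced instance has a block partition into $4c+1$ blocks, a constant number when $c$ is constant. 2. (Perfect completeness.) For every even $N\ge 2$, every instance $\phi$ on $N$ variables, every block partition of $\phi$ into $s\ge1$ blocks, every $K\ge1$ and every assignment $x$ satisfying $\phi$: the state $|\psi_x\rangle$ is a unit vector and the protocol accepts $K$ copies of it with probability exactly $1$. 3. (Constant soundness.) For every $s\in\mathbb N$ and all real $\varepsilon,a,\kappa>0$ there are $\delta>0$ and $N_0$, depending only on $s,\varepsilon,a,\kappa$, such that the following holds. Let $N\ge N_0$ be even, let $\phi$ be an unsatisfiable instance with gap $\varepsilon$ on $N$ variables and with $M$ clauses, $N\le aM$, with a block partition into $s$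 blocks, and let $K\ge\kappa\sqrt N$ (in particular, any $K=\Theta(\sqrt N)$ is allowed). Then for every unit vector $|\varphi\rangle\in\mathbb C^N$ the protocol, run on $K$ copies of $|\varphi\rangle$, accepts with probability at most $1-\delta$. -/

import Mathlib

open scoped BigOperators

noncomputable section

namespace TwoOutOfFour

/-- Pure states (unit vectors are imposed where needed) of the register `ℂ^N` with
computational basis `|i⟩`, `i : Fin N`. -/
abbrev Register (N : ℕ) : Type := EuclideanSpace ℂ (Fin N)

/-- The computational basis vector `|i⟩`. -/
def ket {N : ℕ} (i : Fin N) : Register N := EuclideanSpace.single i (1 : ℂ)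

/-! ### Instances of 2-out-of-4-SAT -/

/-- A clause: four literals on four distinct variables; the `j`-th literal is the variable `var j`,
negated when `neg j = true`. -/
structure Clause (N : ℕ) where
  var : Fin 4 → Fin N
  var_injective : Function.Injective var
  neg : Fin 4 → Bool

/-- An instance with `N` variables and `M` clauses. -/
abbrev Instance (N M : ℕ) : Type := Fin M → Clause N

/-- The truth value of the `j`-th literal of `C` under the assignment `x`. -/
def Clause.literal {N : ℕ} (C : Clause N) (x : Fin N → Bool) (j : Fin 4) : Bool :=
  xor (x (C.var j)) (C.neg j)

/-- A clause is satisfied when exactly two of its four literals are true. -/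
def Clause.Satisfied {N : ℕ} (C : Clause N) (x : Fin N → Bool) : Prop :=
  (Finset.univ.filter fun j : Fin 4 => C.literal x j = true).card = 2

def SatisfiedBy {N M : ℕ} (Φ : Instance N M) (x : Fin N → Bool) : Prop :=
  ∀ C : Fin M, (Φ C).Satisfied x

def Satisfiable {N M : ℕ} (Φ : Instance N M) : Prop :=
  ∃ x : Fin N → Bool, SatisfiedBy Φ x

open Classical in
/-- The number of clauses violated by `x`. -/
def numViolated {N M : ℕ} (Φ : Instance N M) (x : Fin N → Bool) : ℕ :=
  (Finset.univ.filter fun C : Fin M => ¬ (Φ C).Satisfied x).card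

/-- Soundness gap `ε`: the instance is satisfiable, or every assignment violates at least an
`ε` fraction of the clauses. -/
def HasGap {N M : ℕ} (Φ : Instance N M) (ε : ℝ) : Prop :=
  Satisfiable Φ ∨ ∀ x : Fin N → Bool, ε * (M : ℝ) ≤ (numViolated Φ x : ℝ)

/-- Balanced: every variable occurs in at most `c` clauses. -/
def IsBalanced {N M : ℕ} (Φ : Instance N M) (c : ℕ) : Prop :=
  ∀ i : Fin N, (Finset.univ.filter fun C : Fin M => ∃ j : Fin 4, (Φ C).var j = i).card ≤ c

/-- A partition of the clauses into `s` (possibly empty) blocks, such that two different clauses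
in the same block share no variable. -/
structure BlockPartition {N M : ℕ} (Φ : Instance N M) (s : ℕ) where
  block : Fin M → Fin s
  disjoint : ∀ C D : Fin M, C ≠ D → block C = block D →
    ∀ i j : Fin 4, (Φ C).var i ≠ (Φ D).var j

/-! ### Proper states -/

/-- The sign `(-1)^b`. -/
def sign (b : Bool) : ℂ := if b then -1 else 1

/-- The proper state `N^{-1/2} ∑ i, (-1)^{x i} |i⟩`. -/
def properState {N : ℕ} (x : Fin N → Bool) : Register N :=
  ((1 / Real.sqrt (N : ℝ) : ℝ) : ℂ) • ∑ i : Fin N, sign (x i) • ket i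

/-! ### The Satisfiability Test -/

/-- The span of the four basis vectors of a clause. -/
def Clause.space {N : ℕ} (C : Clause N) : Submodule ℂ (Register N) :=
  Submodule.span ℂ (Set.range fun j : Fin 4 => ket (C.var j))

/-- The reduced state `½ ∑ j, (-1)^{x_{i_j}} |i_j⟩` of a clause. -/
def Clause.reducedState {N : ℕ} (C : Clause N) (x : Fin N → Bool) : Register N :=
  (1 / 2 : ℂ) • ∑ j : Fin 4, sign (x (C.var j)) • ket (C.var j)

/-- The span of the reduced states of the satisfying assignments of a clause. -/
def Clause.acceptSpace {N : ℕ} (C : Clause N) : Submodule ℂ (Register N) :=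
  Submodule.span ℂ {v | ∃ x : Fin N → Bool, C.Satisfied x ∧ v = C.reducedState x}

open Classical in
/-- Acceptance probability of the Satisfiability Test on `v` when block `r` is chosen: `v` is
measured with one projector per clause of the block and one for the orthogonal complement of all
of them. On the latter outcome Arthur accepts. On outcome `C` (probability `‖P_C v‖²`, reduced
state `P_C v / ‖P_C v‖`) he performs the projective measurement with accepting projector `Q_C`
onto `C.acceptSpace`, so that "outcome `C` and then accept" has probability `‖Q_C P_C v‖²`. -/
def blockAcceptProb {N M s : ℕ} {Φ : Instance N M} (B : BlockPartition Φ s) (r : Fin s)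
    (v : Register N) : ℝ :=
  ‖(⨆ C : {C : Fin M // B.block C = r}, (Φ C).space)ᗮ.starProjection v‖ ^ 2 +
    ∑ C ∈ Finset.univ.filter (fun C : Fin M => B.block C = r),
      ‖(Φ C).acceptSpace.starProjection ((Φ C).space.starProjection v)‖ ^ 2

/-- Acceptance probability of the Satisfiability Test: the block is uniformly random. -/
def satTestProb {N M s : ℕ} {Φ : Instance N M} (B : BlockPartition Φ s) (v : Register N) : ℝ :=
  (∑ r : Fin s, blockAcceptProb B r v) / (s : ℝ)

/-! ### The Uniformity Test -/

/-- Perfect matchings on `Fin N`, encoded as fixed-point-free involutions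
(`σ i` is the partner of `i`). -/
abbrev Matching (N : ℕ) : Type :=
  {σ : Equiv.Perm (Fin N) // (∀ i, σ (σ i) = i) ∧ ∀ i, σ i ≠ i}

/-- Edges of a matching, each represented by its smaller endpoint. -/
abbrev Matching.Edge {N : ℕ} (m : Matching N) : Type := {i : Fin N // i < m.1 i}

/-- Measurement outcomes: an edge `(i, j)` and a sign (`false` for `+`, `true` for `-`). -/
abbrev Matching.Outcome {N : ℕ} (m : Matching N) : Type := m.Edge × Bool

/-- The element `(|i⟩ ± |j⟩) / √2` of the measurement basis. -/
def Matching.basisVec {N : ℕ} (m : Matching N) (o : m.Outcome) : Register N :=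
  ((1 / Real.sqrt 2 : ℝ) : ℂ) • (ket o.1.1 + sign o.2 • ket (m.1 o.1.1))

/-- Both outcomes `+` and `-` occur for some edge. -/
def Matching.Disagreement {N K : ℕ} (m : Matching N) (o : Fin K → m.Outcome) : Prop :=
  ∃ k l : Fin K, (o k).1 = (o l).1 ∧ (o k).2 ≠ (o l).2

open Classical in
/-- Acceptance probability of the Uniformity Test on the product state `w 0 ⊗ ⋯ ⊗ w (K-1)`, given
the matching: the `K` outcomes are independent, and Arthur accepts unless there is a
disagreement. -/
def Matching.acceptProb {N K : ℕ} (m : Matching N) (w : Fin K → Register N) : ℝ :=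
  ∑ o ∈ Finset.univ.filter (fun o : Fin K → m.Outcome => ¬ m.Disagreement o),
    ∏ k : Fin K, ‖inner ℂ (m.basisVec (o k)) (w k)‖ ^ 2

/-- Acceptance probability of the Uniformity Test: the perfect matching is uniformly random. -/
def uniformityTestProb {N K : ℕ} (w : Fin K → Register N) : ℝ :=
  (∑ m : Matching N, m.acceptProb w) / (Fintype.card (Matching N) : ℝ)

/-! ### The protocol -/

/-- Acceptance probability of the protocol on the witnesses `w`: with probability `1/2` the
Satisfiability Test on the `k`-th witness, with probability `1/2` the Uniformity Test. -/
def protocolProb {N M s K : ℕ} {Φ : Instance N M} (B : BlockPartition Φ s) (k : Fin K)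
    (w : Fin K → Register N) : ℝ :=
  (1 / 2) * satTestProb B (w k) + (1 / 2) * uniformityTestProb w

end TwoOutOfFour

end

noncomputable section

namespace TwoOutOfFour

/-! ### Block partitions of balanced instances -/

/-! Completeness: a clause's projection of a proper state is a multiple of a reduced state of the
same assignment, and on every matching edge the two amplitudes agree up to sign, so one of the two
outcomes has probability zero.

Soundness is a dichotomy on how far the amplitudes of `v` are from being equal up to sign. For an
edge `(i, j)`, `pairGap v i j` is the smaller of the two outcome probabilities. If these gaps sum to
a constant for a given matching, a birthday argument (`avoidProb_add_le`) shows that order `√N`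
samples collide with constant probability. The partner of a vertex is uniform
(`Matching.sum_partner`), so if the average over matchings is at least a constant, the Uniformity
Test rejects with constant probability.

Otherwise some row `∑ j, pairGap v i j` is small, and rounding every amplitude to `± v i` puts `v`
near a multiple of a sign vector (`exists_signs_near`). By the gap, that assignment violates many
clauses. Each clause has a unit vector `checkVec` orthogonal to its accepting space, which overlaps
the sign vector of a violating assignment by at least 1. Since check vectors within a block obey
Bessel's inequality, the overlaps survive the perturbation to `v`, and the Satisfiability Test
rejects with constant probability (`satTestProb_le_of_near`). -/

/-- Greedy colouring of a finite set of vertices. -/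
theorem exists_coloring_of_degree_lt {α : Type*} [DecidableEq α] (r : α → α → Prop)
    (hr : ∀ a b, r a b → r b a) (n : ℕ) (T : Finset α)
    (hdeg : ∀ a, ∃ F : Finset α, F.card < n ∧ ∀ b, r a b → b ∈ F) :
    ∃ col : α → Fin n, ∀ a ∈ T, ∀ b ∈ T, a ≠ b → r a b → col a ≠ col b := by
  classical
  induction T using Finset.induction_on with
  | empty =>
    by_cases hα : Nonempty α
    · obtain ⟨F, hF, -⟩ := hdeg hα.some
      exact ⟨fun _ => ⟨0, by omega⟩, by simp⟩
    · exact ⟨fun a => (hα ⟨a⟩).elim, by simp⟩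
  | insert a T ha ih =>
    obtain ⟨col, hcol⟩ := ih
    obtain ⟨F, hF, hFr⟩ := hdeg a
    have hlt : (F.image col).card < (Finset.univ : Finset (Fin n)).card := by
      simpa using lt_of_le_of_lt Finset.card_image_le hF
    obtain ⟨z, -, hz⟩ := Finset.exists_mem_notMem_of_card_lt_card hlt
    have hz' : ∀ b, r a b → z ≠ col b := fun b hb h =>
      hz (h ▸ Finset.mem_image_of_mem col (hFr b hb))
    refine ⟨Function.update col a z, ?_⟩
    intro b hb c hc hbc hrbc
    rcases Finset.mem_insert.1 hb with rfl | hbT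
    · rw [Function.update_self, Function.update_of_ne hbc.symm]
      exact hz' c hrbc
    · have hba : b ≠ a := fun h => ha (h ▸ hbT)
      rcases Finset.mem_insert.1 hc with rfl | hcT
      · rw [Function.update_self, Function.update_of_ne hba]
        exact (hz' b (hr _ _ hrbc)).symm
      · have hca : c ≠ a := fun h => ha (h ▸ hcT)
        rw [Function.update_of_ne hba, Function.update_of_ne hca]
        exact hcol b hbT c hcT hbc hrbc

theorem exists_blockPartition {c N M : ℕ} (Φ : Instance N M) (h : IsBalanced Φ c) :
    Nonempty (BlockPartition Φ (4 * c + 1)) := by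
  classical
  obtain ⟨col, hcol⟩ := exists_coloring_of_degree_lt
    (fun C D : Fin M => ∃ i j, (Φ C).var i = (Φ D).var j)
    (fun C D ⟨i, j, hij⟩ => ⟨j, i, hij.symm⟩) (4 * c + 1) Finset.univ (fun C => by
      -- The conflicts of `C` lie in the union, over its four variables, of the clauses containing
      -- that variable: at most `4 * c` in all.
      refine ⟨Finset.univ.biUnion fun i : Fin 4 =>
        Finset.univ.filter fun D : Fin M => ∃ j : Fin 4, (Φ D).var j = (Φ C).var i, ?_, ?_⟩
      · have := Finset.card_biUnion_le_card_mul Finset.univ (fun i : Fin 4 =>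
          Finset.univ.filter fun D : Fin M => ∃ j : Fin 4, (Φ D).var j = (Φ C).var i) c
          (fun i _ => by convert h ((Φ C).var i))
        simp only [Finset.card_univ, Fintype.card_fin] at this
        omega
      · rintro D ⟨i, j, hij⟩
        simp only [Finset.mem_biUnion, Finset.mem_univ, Finset.mem_filter, true_and]
        exact ⟨i, j, hij.symm⟩)
  exact ⟨⟨col, fun C D hCD hb i j hij =>
    hcol C (Finset.mem_univ _) D (Finset.mem_univ _) hCD ⟨i, j, hij⟩ hb⟩⟩

/-! ### Perfect matchings -/

theorem Matching.nonempty_of_even {N : ℕ} (hN : Even N) : Nonempty (Matching N) := by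
  -- Reversal `i ↦ N - 1 - i` has a fixed point only for odd `N`.
  refine ⟨⟨Fin.revPerm, fun i => by simp, fun i h => ?_⟩⟩
  obtain ⟨k, hk⟩ := hN
  have h1 := congrArg Fin.val h
  have := i.isLt
  simp only [Fin.revPerm_apply, Fin.val_rev] at h1
  omega

theorem Matching.sum_edge {N : ℕ} (m : Matching N) (g : Fin N → ℝ) :
    ∑ e : m.Edge, (g e.1 + g (m.1 e.1)) = ∑ i, g i := by
  classical
  have h1 : ∑ e : m.Edge, (g e.1 + g (m.1 e.1)) =
      ∑ i ∈ Finset.univ.filter (fun i => i < m.1 i), (g i + g (m.1 i)) :=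
    (Finset.sum_subtype _ (by simp) (fun i => g i + g (m.1 i))).symm
  have h2 : ∑ i ∈ Finset.univ.filter (fun i => i < m.1 i), g (m.1 i) =
      ∑ i ∈ Finset.univ.filter (fun i => ¬ i < m.1 i), g i := by
    refine Finset.sum_bij' (fun i _ => m.1 i) (fun i _ => m.1 i) ?_ ?_ ?_ ?_ ?_
    · intro i hi
      simp only [Finset.mem_filter, Finset.mem_univ, true_and] at hi ⊢
      rw [m.2.1]; exact hi.not_gt
    · intro i hi
      simp only [Finset.mem_filter, Finset.mem_univ, true_and] at hi ⊢
      rw [m.2.1]; exact lt_of_le_of_ne (not_lt.1 hi) (m.2.2 i)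
    · intro i _; exact m.2.1 i
    · intro i _; exact m.2.1 i
    · intro i _; rfl
  rw [h1, Finset.sum_add_distrib, h2, Finset.sum_filter_add_sum_filter_not]

/-- Conjugation of a matching by a permutation. -/
def Matching.conj {N : ℕ} (τ : Equiv.Perm (Fin N)) (m : Matching N) : Matching N :=
  ⟨τ * m.1 * τ⁻¹, fun i => by simp [m.2.1], fun i h => m.2.2 (τ⁻¹ i) (by
    rw [Equiv.Perm.eq_inv_iff_eq]; simpa using h)⟩

theorem Matching.conj_apply {N : ℕ} (τ : Equiv.Perm (Fin N)) (m : Matching N) (i : Fin N) :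
    (m.conj τ).1 i = τ (m.1 (τ⁻¹ i)) := rfl

/-- Conjugating by the transposition of `j` and `j'` fixes `i` and carries partner `j` to partner
`j'`. By symmetry all these counts are equal. -/
theorem Matching.card_partner_le {N : ℕ} (i j j' : Fin N) (hj : j ≠ i) (hj' : j' ≠ i) :
    (Finset.univ.filter fun m : Matching N => m.1 i = j).card ≤
      (Finset.univ.filter fun m : Matching N => m.1 i = j').card := by
  classical
  refine Finset.card_le_card_of_injOn (fun m => m.conj (Equiv.swap j j')) ?_ ?_
  · intro m hm
    simp only [Finset.coe_filter, Finset.mem_univ, true_and, Set.mem_ofPred_eq] at hm ⊢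
    rw [Matching.conj_apply, Equiv.swap_inv, Equiv.swap_apply_of_ne_of_ne hj.symm hj'.symm, hm,
      Equiv.swap_apply_left]
  · intro m _ m' _ h
    apply Subtype.ext
    have := congrArg Subtype.val h
    simpa [Matching.conj] using this

/-- The partner of a vertex in a random matching is uniform among the other vertices. -/
theorem Matching.sum_partner {N : ℕ} (i : Fin N) (g : Fin N → ℝ) (hg : ∀ j, 0 ≤ g j)
    (hi : g i = 0) :
    (Fintype.card (Matching N) : ℝ) * ∑ j, g j ≤ N * ∑ m : Matching N, g (m.1 i) := by
  classical
  set c : Fin N → ℕ := fun j => (Finset.univ.filter fun m : Matching N => m.1 i = j).card with hc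
  have hcard : (Fintype.card (Matching N) : ℝ) = ∑ j, (c j : ℝ) := by
    rw [← Nat.cast_sum, ← Finset.card_univ]
    congr 1
    exact Finset.card_eq_sum_card_fiberwise (f := fun m : Matching N => m.1 i)
      (fun _ _ => Finset.mem_coe.2 (Finset.mem_univ _))
  have hsum : ∑ m : Matching N, g (m.1 i) = ∑ j, (c j : ℝ) * g j := by
    rw [← Finset.sum_fiberwise Finset.univ (fun m : Matching N => m.1 i)]
    refine Finset.sum_congr rfl fun j _ => ?_
    rw [Finset.sum_congr rfl (g := fun _ => g j) (fun m hm => by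
      rw [(Finset.mem_filter.1 hm).2]), Finset.sum_const, nsmul_eq_mul]
  have hci : c i = 0 := by
    rw [hc]
    simp only [Finset.card_eq_zero, Finset.filter_eq_empty_iff, Finset.mem_univ, true_implies]
    exact fun m => m.2.2 i
  rw [hcard, hsum, Finset.sum_mul]
  -- Each of the `N` values `j'` is bounded by the same right side. The exact factor is `N - 1`;
  -- counting the empty fibre over `i` as well costs nothing that matters.
  have : ∀ j' ∈ Finset.univ, (c j' : ℝ) * ∑ j, g j ≤ ∑ j, (c j : ℝ) * g j := by
    intro j' _
    rw [Finset.mul_sum]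
    refine Finset.sum_le_sum fun j _ => ?_
    by_cases hj : j = i
    · rw [hj, hi]; simp
    by_cases hj' : j' = i
    · rw [hj', hci]; simpa using mul_nonneg (Nat.cast_nonneg _) (hg j)
    · exact mul_le_mul_of_nonneg_right
        (by exact_mod_cast Matching.card_partner_le i j' j hj' hj) (hg j)
  refine (Finset.sum_le_sum this).trans ?_
  simp

/-! ### Collisions among independent samples -/

section Collision

variable {Ω : Type*} [Fintype Ω] [DecidableEq Ω]

/-- For independent samples from `p`, the probability that `n` further samples produce no pair
`ω, f ω`, neither among themselves nor with the set `S` of values seen before. -/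
def avoidProb (p : Ω → ℝ) (f : Ω → Ω) : ℕ → Finset Ω → ℝ
  | 0, _ => 1
  | n + 1, S => ∑ ω, if f ω ∈ S then 0 else p ω * avoidProb p f n (insert ω S)

theorem avoidProb_nonneg {p : Ω → ℝ} (hp : ∀ ω, 0 ≤ p ω) (f : Ω → Ω) (n : ℕ) (S : Finset Ω) :
    0 ≤ avoidProb p f n S := by
  induction n generalizing S with
  | zero => simp [avoidProb]
  | succ n ih =>
    refine Finset.sum_nonneg fun ω _ => ?_
    split_ifs
    · exact le_rfl
    · exact mul_nonneg (hp ω) (ih _)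

-- Peeling off the first sample matches the recursion of `avoidProb`. Only an inequality holds,
-- because the filter also tests a sample against itself and against later ones.
open Classical in
theorem sum_noCollision_le_avoidProb {p : Ω → ℝ} (hp : ∀ ω, 0 ≤ p ω) (f : Ω → Ω) (n : ℕ)
    (S : Finset Ω) :
    ∑ o ∈ Finset.univ.filter (fun o : Fin n → Ω =>
      (∀ k, f (o k) ∉ S) ∧ ∀ k l, f (o k) ≠ o l), ∏ k, p (o k) ≤ avoidProb p f n S := by
  induction n generalizing S with
  | zero =>
    refine (Finset.sum_le_sum_of_subset_of_nonneg (Finset.subset_univ _)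
      (fun o _ _ => Finset.prod_nonneg fun k _ => hp _)).trans ?_
    simp [avoidProb]
  | succ n ih =>
    rw [Finset.sum_filter, ← (Fin.consEquiv fun _ => Ω).sum_comp, Fintype.sum_prod_type, avoidProb]
    refine Finset.sum_le_sum fun ω _ => ?_
    by_cases hω : f ω ∈ S
    · rw [if_pos hω]
      refine (Finset.sum_eq_zero fun o _ => if_neg fun h => ?_).le
      exact h.1 0 (by simpa [Fin.consEquiv] using hω)
    · rw [if_neg hω]
      refine le_trans ?_ (mul_le_mul_of_nonneg_left (ih (insert ω S)) (hp ω))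
      rw [Finset.mul_sum, Finset.sum_filter]
      refine Finset.sum_le_sum fun o _ => ?_
      by_cases h : (∀ k, f ((Fin.consEquiv fun _ => Ω) (ω, o) k) ∉ S) ∧
          ∀ k l, f ((Fin.consEquiv fun _ => Ω) (ω, o) k) ≠ (Fin.consEquiv fun _ => Ω) (ω, o) l
      · rw [if_pos h, if_pos, Fin.prod_univ_succ]
        · simp [Fin.consEquiv]
        · refine ⟨fun k hk => ?_, fun k l => ?_⟩
          · rcases Finset.mem_insert.1 hk with hk | hk
            · exact h.2 k.succ 0 (by simpa [Fin.consEquiv] using hk)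
            · exact h.1 k.succ (by simpa [Fin.consEquiv] using hk)
          · simpa [Fin.consEquiv] using h.2 k.succ l.succ
      · rw [if_neg h]
        split_ifs
        · exact mul_nonneg (hp _) (Finset.prod_nonneg fun k _ => hp _)
        · exact le_rfl

variable {p q : Ω → ℝ} {f : Ω → Ω}

/-- Collisions with the initial set `S` alone already give this: a sample lands in `f ⁻¹ S` with
probability at least the `q`-mass of `S`, and the set of seen values only grows. -/
theorem avoidProb_le_pow (hp : ∀ ω, 0 ≤ p ω) (hp1 : ∑ ω, p ω = 1) (hf : ∀ ω, f (f ω) = ω)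
    (hq : ∀ ω, 0 ≤ q ω) (hqf : ∀ ω, q ω ≤ p (f ω)) (n : ℕ) (S : Finset Ω) :
    avoidProb p f n S ≤ (1 - ∑ ω ∈ S, q ω) ^ n := by
  have hinv : Function.Involutive f := hf
  have hmass : ∀ S : Finset Ω, ∑ ω, (if f ω ∈ S then 0 else p ω) ≤ 1 - ∑ ω ∈ S, q ω := by
    intro S
    have h1 : ∑ ω, (if f ω ∈ S then p ω else 0) = ∑ ω ∈ S, p (f ω) := by
      rw [← Equiv.sum_comp hinv.toPerm]
      simp [hf]
    have h2 : ∑ ω, (if f ω ∈ S then 0 else p ω) + ∑ ω, (if f ω ∈ S then p ω else 0) = 1 := by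
      rw [← Finset.sum_add_distrib, ← hp1]
      exact Finset.sum_congr rfl fun ω _ => by split_ifs <;> simp
    have h3 : ∑ ω ∈ S, q ω ≤ ∑ ω ∈ S, p (f ω) := Finset.sum_le_sum fun ω _ => hqf ω
    linarith
  have hnn : ∀ S : Finset Ω, 0 ≤ 1 - ∑ ω ∈ S, q ω := fun S =>
    (Finset.sum_nonneg fun ω _ => by split_ifs; exacts [le_rfl, hp ω]).trans (hmass S)
  induction n generalizing S with
  | zero => simp [avoidProb]
  | succ n ih =>
    rw [avoidProb, pow_succ']
    refine le_trans ?_ (mul_le_mul_of_nonneg_right (hmass S) (pow_nonneg (hnn S) n))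
    rw [Finset.sum_mul]
    refine Finset.sum_le_sum fun ω _ => ?_
    split_ifs
    · simp
    · refine mul_le_mul_of_nonneg_left ((ih _).trans ?_) (hp ω)
      refine pow_le_pow_left₀ (hnn _) ?_ n
      have := Finset.sum_le_sum_of_subset_of_nonneg (Finset.subset_insert ω S)
        (fun ω _ _ => hq ω)
      linarith

/-- If `q ≤ p` has mass at least `μ / 2` on a set `G` of points of weight at least `c`, then
collisions are likely. -/
theorem avoidProb_add_le (hp : ∀ ω, 0 ≤ p ω) (hp1 : ∑ ω, p ω = 1) (hf : ∀ ω, f (f ω) = ω)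
    (hq : ∀ ω, 0 ≤ q ω) (hqp : ∀ ω, q ω ≤ p ω) (hqf : ∀ ω, q ω ≤ p (f ω)) {μ c : ℝ}
    (hμ : 0 ≤ μ) (hc : 0 ≤ c) (G : Finset Ω) (hGc : ∀ ω ∈ G, c ≤ q ω) (hG : μ / 2 ≤ ∑ ω ∈ G, q ω)
    (n j : ℕ) (S : Finset Ω) :
    avoidProb p f (n + j) S ≤ Real.exp (-(n * (μ / 4))) +
      Real.exp (-(n * c)) ^ (S ∩ G).card * (1 - (1 - Real.exp (-(n * c))) * (μ / 4)) ^ j := by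
  set t := Real.exp (-(n * c)) with ht
  have ht0 : 0 < t := Real.exp_pos _
  have ht1 : t ≤ 1 := Real.exp_le_one_iff.2 (by have := mul_nonneg (Nat.cast_nonneg n) hc; linarith)
  have hq1 : ∀ S : Finset Ω, ∑ ω ∈ S, q ω ≤ 1 := fun S => by
    rw [← hp1]
    exact (Finset.sum_le_sum fun ω _ => hqp ω).trans
      (Finset.sum_le_univ_sum_of_nonneg hp)
  have hμ2 : μ / 2 ≤ 1 := hG.trans (hq1 G)
  have hρ : 0 ≤ 1 - (1 - t) * (μ / 4) := by nlinarith
  have hexp : ∀ (k : ℕ) (S : Finset Ω), avoidProb p f k S ≤ Real.exp (-(k * ∑ ω ∈ S, q ω)) := by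
    intro k S
    refine (avoidProb_le_pow hp hp1 hf hq hqf k S).trans ?_
    refine (pow_le_pow_left₀ (by linarith [hq1 S]) (Real.one_sub_le_exp_neg _) k).trans ?_
    rw [← Real.exp_nat_mul, mul_neg]
  induction j generalizing S with
  -- With no exploratory samples left, each point of `S ∩ G` contributes at least `c` to the chance
  -- that any one of the last `n` samples collides.
  | zero =>
    have h1 := hexp n S
    have h2 : Real.exp (-(n * ∑ ω ∈ S, q ω)) ≤ t ^ (S ∩ G).card := by
      rw [ht, ← Real.exp_nat_mul, Real.exp_le_exp]
      have h3 : ((S ∩ G).card : ℝ) * c ≤ ∑ ω ∈ S, q ω := by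
        rw [← nsmul_eq_mul]
        refine (Finset.card_nsmul_le_sum _ _ _ fun ω hω =>
          hGc ω (Finset.mem_inter.1 hω).2).trans ?_
        exact Finset.sum_le_sum_of_subset_of_nonneg Finset.inter_subset_left fun ω _ _ => hq ω
      nlinarith [mul_le_mul_of_nonneg_left h3 (Nat.cast_nonneg (α := ℝ) n)]
    have := Real.exp_pos (-(n * (μ / 4)))
    simp only [add_zero, pow_zero, mul_one]
    linarith
  | succ j ih =>
    -- If `S` is already heavy, the remaining samples, at least `n` of them, collide with it. If it
    -- is light, `G \ S` still has mass at least `μ / 4`, so the next sample enlarges `S ∩ G` with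
    -- that probability, and the expected potential `t ^ (S ∩ G).card` shrinks by the factor `ρ`.
    by_cases hS : μ / 4 ≤ ∑ ω ∈ S, q ω
    · refine (hexp _ S).trans ?_
      have h1 : Real.exp (-(((n + (j + 1) : ℕ) : ℝ) * ∑ ω ∈ S, q ω)) ≤
          Real.exp (-(n * (μ / 4))) := by
        rw [Real.exp_le_exp, neg_le_neg_iff]
        exact mul_le_mul (by push_cast; linarith [Nat.cast_nonneg (α := ℝ) j]) hS (by linarith)
          (Nat.cast_nonneg _)
      have h2 : 0 ≤ t ^ (S ∩ G).card * (1 - (1 - t) * (μ / 4)) ^ (j + 1) := by positivity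
      linarith
    · push Not at hS
      have hnew : μ / 4 ≤ ∑ ω ∈ G \ S, p ω := by
        have h1 : ∑ ω ∈ G \ S, q ω + ∑ ω ∈ G ∩ S, q ω = ∑ ω ∈ G, q ω := by
          rw [add_comm]; exact Finset.sum_inter_add_sum_sdiff G S q
        have h2 : ∑ ω ∈ G ∩ S, q ω ≤ ∑ ω ∈ S, q ω :=
          Finset.sum_le_sum_of_subset_of_nonneg Finset.inter_subset_right fun ω _ _ => hq ω
        have h3 : ∑ ω ∈ G \ S, q ω ≤ ∑ ω ∈ G \ S, p ω := Finset.sum_le_sum fun ω _ => hqp ω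
        linarith
      set θ := Real.exp (-(n * (μ / 4)))
      set ρ := 1 - (1 - t) * (μ / 4) with hρdef
      have hstep : ∀ ω, (if f ω ∈ S then 0 else p ω * avoidProb p f (n + j) (insert ω S)) ≤
          p ω * θ + t ^ (S ∩ G).card * ρ ^ j * (p ω - (1 - t) * if ω ∈ G \ S then p ω else 0) := by
        intro ω
        have hle : (if f ω ∈ S then 0 else p ω * avoidProb p f (n + j) (insert ω S)) ≤
            p ω * avoidProb p f (n + j) (insert ω S) := by
          split_ifs
          · exact mul_nonneg (hp ω) (avoidProb_nonneg hp f _ _)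
          · exact le_rfl
        refine hle.trans ((mul_le_mul_of_nonneg_left (ih (insert ω S)) (hp ω)).trans ?_)
        by_cases hω : ω ∈ G \ S
        · obtain ⟨hωG, hωS⟩ := Finset.mem_sdiff.1 hω
          rw [if_pos hω, Finset.insert_inter_of_mem hωG, Finset.card_insert_of_notMem
            (fun h => hωS (Finset.mem_inter.1 h).1), pow_succ]
          apply le_of_eq; ring
        · rw [if_neg hω]
          have h1 : (S ∩ G).card ≤ (insert ω S ∩ G).card :=
            Finset.card_le_card (Finset.inter_subset_inter_right (Finset.subset_insert _ _))
          have h2 : t ^ (insert ω S ∩ G).card * ρ ^ j ≤ t ^ (S ∩ G).card * ρ ^ j :=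
            mul_le_mul_of_nonneg_right (pow_le_pow_of_le_one ht0.le ht1 h1) (pow_nonneg hρ j)
          nlinarith [mul_le_mul_of_nonneg_left h2 (hp ω)]
      rw [← add_assoc, avoidProb]
      refine (Finset.sum_le_sum fun ω _ => hstep ω).trans ?_
      rw [Finset.sum_add_distrib, ← Finset.sum_mul, ← Finset.mul_sum, Finset.sum_sub_distrib,
        ← Finset.mul_sum, hp1, Finset.sum_ite_mem, Finset.univ_inter, one_mul, pow_succ,
        ← mul_assoc]
      refine add_le_add_right (mul_le_mul_of_nonneg_left ?_ (by positivity)) _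
      rw [hρdef]
      nlinarith

end Collision

-- Half of the samples explore and half collide. With both halves of order `√N`, one exploratory
-- step shrinks the potential by `1 - Θ(1/√N)`, so the second term stays below a constant `r < 1`,
-- while the first term tends to 0.
open Filter Topology in
theorem exists_collision_bound (μ κ : ℝ) (hμ : 0 < μ) (hκ : 0 < κ) :
    ∃ δ : ℝ, 0 < δ ∧ ∃ N₀ : ℕ, ∀ N K : ℕ, N₀ ≤ N → κ * Real.sqrt N ≤ K → μ ≤ 1 →
      ∃ n j : ℕ, n + j = K ∧ Real.exp (-(n * (μ / 4))) +
        (1 - (1 - Real.exp (-(n * (μ / (2 * N))))) * (μ / 4)) ^ j ≤ 1 - δ := by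
  set r := Real.exp (-(κ ^ 2 * μ ^ 2 / 256)) with hr
  have hr1 : r < 1 := Real.exp_lt_one_iff.2 (neg_lt_zero.2 (by positivity))
  have hsq : Tendsto (fun N : ℕ => Real.sqrt N) atTop atTop :=
    Real.tendsto_sqrt_atTop.comp tendsto_natCast_atTop_atTop
  have hlim : Tendsto (fun N : ℕ => Real.exp (-(κ * μ / 16 * Real.sqrt N))) atTop (𝓝 0) :=
    Real.tendsto_exp_neg_atTop_nhds_zero.comp (hsq.const_mul_atTop (by positivity))
  -- The first condition makes the first term at most `(1 - r) / 2`; the others give `2 ≤ K` (so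
  -- halving loses at most a factor 2), `x ≤ 1`, and `0 < R`.
  have hev := ((hlim.eventually (gt_mem_nhds (show 0 < (1 - r) / 2 by linarith))).and
    ((hsq.eventually_ge_atTop (2 / κ)).and ((hsq.eventually_ge_atTop (κ * μ / 8)).and
      (hsq.eventually_ge_atTop 1))))
  obtain ⟨N₀, hN₀⟩ := eventually_atTop.1 hev
  refine ⟨(1 - r) / 2, by linarith, N₀, fun N K hN hK hμ1 => ?_⟩
  obtain ⟨h1, h2, h3, h4⟩ := hN₀ N hN
  set R := Real.sqrt N with hR
  have hRpos : 0 < R := by linarith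
  have hRN : R ^ 2 = N := Real.sq_sqrt (Nat.cast_nonneg N)
  have hK2 : (2 : ℝ) ≤ K := by
    rw [div_le_iff₀ hκ] at h2; linarith
  have hK2' : 2 ≤ K := by exact_mod_cast hK2
  have hn : κ * R / 4 ≤ ((K / 2 : ℕ) : ℝ) := by
    have : (K : ℝ) ≤ 4 * ((K / 2 : ℕ) : ℝ) := by exact_mod_cast (by omega : K ≤ 4 * (K / 2))
    linarith
  have hj : κ * R / 4 ≤ ((K - K / 2 : ℕ) : ℝ) :=
    hn.trans (by exact_mod_cast (by omega : K / 2 ≤ K - K / 2))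
  refine ⟨K / 2, K - K / 2, by omega, ?_⟩
  set n := K / 2
  set j := K - n
  have hfirst : Real.exp (-(n * (μ / 4))) ≤ Real.exp (-(κ * μ / 16 * R)) := by
    rw [Real.exp_le_exp]; nlinarith
  set x := κ * μ / (8 * R) with hx
  have hxpos : 0 < x := by positivity
  have hx1 : x ≤ 1 := by rw [hx, div_le_one (by positivity)]; linarith
  have hxn : x ≤ n * (μ / (2 * N)) := by
    have : x = κ * R / 4 * (μ / (2 * N)) := by
      rw [hx, ← hRN]; field_simp; ring
    rw [this]; gcongr
  have ht : x / 2 ≤ 1 - Real.exp (-(n * (μ / (2 * N)))) := by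
    have h5 : Real.exp (-(n * (μ / (2 * N)))) ≤ Real.exp (-x) := by
      rw [Real.exp_le_exp]; linarith
    have h6 : Real.exp (-x) ≤ 1 / (1 + x) := by
      rw [Real.exp_neg, ← one_div]
      exact one_div_le_one_div_of_le (by linarith) (by linarith [Real.add_one_le_exp x])
    have h7 : 1 / (1 + x) ≤ 1 - x / 2 := by
      rw [div_le_iff₀ (by linarith)]; nlinarith
    linarith
  have hsecond : (1 - (1 - Real.exp (-(n * (μ / (2 * N))))) * (μ / 4)) ^ j ≤ r := by
    set y := (1 - Real.exp (-(n * (μ / (2 * N))))) * (μ / 4) with hy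
    have hy1 : y ≤ 1 := by
      have := Real.exp_pos (-(n * (μ / (2 * N))))
      rw [hy]; nlinarith
    have hy2 : x / 2 * (μ / 4) ≤ y := by rw [hy]; gcongr
    refine (pow_le_pow_left₀ (by linarith) (Real.one_sub_le_exp_neg y) j).trans ?_
    rw [← Real.exp_nat_mul, hr, Real.exp_le_exp, mul_neg, neg_le_neg_iff]
    have h8 : κ * R / 4 * (x / 2 * (μ / 4)) ≤ j * y := by gcongr
    have h9 : κ * R / 4 * (x / 2 * (μ / 4)) = κ ^ 2 * μ ^ 2 / 256 := by
      rw [hx]; field_simp; ring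
    linarith
  linarith

/-! ### The Satisfiability Test -/

theorem norm_sq_eq_orthogonal_add_sum {E ι : Type*} [NormedAddCommGroup E] [InnerProductSpace ℂ E]
    [FiniteDimensional ℂ E] [Fintype ι] (U : ι → Submodule ℂ E)
    (hU : Pairwise fun i j => U i ⟂ U j) (v : E) :
    ‖v‖ ^ 2 = ‖(⨆ i, U i)ᗮ.starProjection v‖ ^ 2 + ∑ i, ‖(U i).starProjection v‖ ^ 2 := by
  classical
  -- For pairwise orthogonal subspaces the projection onto the supremum is the sum of the
  -- projections; Pythagoras then gives the claim.
  have hproj : (⨆ i, U i).starProjection v = ∑ i, (U i).starProjection v := by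
    refine Submodule.eq_starProjection_of_mem_orthogonal (Submodule.sum_mem _ fun i _ =>
      Submodule.mem_iSup_of_mem i (Submodule.starProjection_apply_mem _ _)) ?_
    rw [← Submodule.iInf_orthogonal, Submodule.mem_iInf]
    intro i
    rw [← Finset.add_sum_erase _ _ (Finset.mem_univ i), ← sub_sub]
    refine Submodule.sub_mem _ (Submodule.sub_starProjection_mem_orthogonal _)
      (Submodule.sum_mem _ fun j hj => ?_)
    exact (hU (Finset.ne_of_mem_erase hj)) (Submodule.starProjection_apply_mem _ _)
  rw [Submodule.norm_sq_eq_add_norm_sq_starProjection v (⨆ i, U i), add_comm]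
  congr 1
  have hre : ∀ K : Submodule ℂ E, RCLike.re (inner ℂ (K.starProjection v) v) =
      ‖K.starProjection v‖ ^ 2 := fun K => by
    rw [Submodule.re_inner_starProjection_eq_normSq, Submodule.starProjection_apply,
      Submodule.coe_norm]
  rw [← hre, hproj, sum_inner, map_sum]
  exact Finset.sum_congr rfl fun i _ => hre _

theorem inner_ket {N : ℕ} (i : Fin N) (v : Register N) : inner ℂ (ket i) v = v i := by
  rw [ket, EuclideanSpace.inner_single_left, map_one, one_mul]

theorem ket_apply {N : ℕ} (i j : Fin N) : (ket i : Register N) j = if j = i then 1 else 0 := by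
  simp [ket]

theorem star_sign (b : Bool) : (starRingEnd ℂ) (sign b) = sign b := by cases b <;> simp [sign]

theorem sign_mul_self (b : Bool) : sign b * sign b = 1 := by cases b <;> simp [sign]

theorem norm_sign (b : Bool) : ‖sign b‖ = 1 := by cases b <;> simp [sign]

theorem sum_sign_apply {N : ℕ} (x : Fin N → Bool) (i : Fin N) :
    (∑ j, sign (x j) • ket j : Register N) i = sign (x i) := by
  simp [WithLp.ofLp_sum, ket_apply]

theorem Clause.sum_smul_ket_apply {N : ℕ} (C : Clause N) (a : Fin 4 → ℂ) (j : Fin 4) :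
    (∑ l, a l • ket (C.var l) : Register N) (C.var j) = a j := by
  simp [WithLp.ofLp_sum, ket_apply, C.var_injective.eq_iff]

theorem Clause.mem_space_orthogonal {N : ℕ} (C : Clause N) (v : Register N)
    (hv : ∀ j, v (C.var j) = 0) : v ∈ C.spaceᗮ := by
  rw [Submodule.mem_orthogonal]
  intro u hu
  induction hu using Submodule.span_induction with
  | mem u hu =>
    obtain ⟨j, rfl⟩ := hu
    rw [inner_ket, hv]
  | zero => simp
  | add a b _ _ ha hb => rw [inner_add_left, ha, hb, add_zero]
  | smul c a _ ha => rw [inner_smul_left, ha, mul_zero]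

/-- The unit vector `½ ∑ j, (-1)^{neg j} |i_j⟩`, orthogonal to the accepting space. -/
def Clause.checkVec {N : ℕ} (C : Clause N) : Register N :=
  (1 / 2 : ℂ) • ∑ j : Fin 4, sign (C.neg j) • ket (C.var j)

theorem Clause.inner_checkVec {N : ℕ} (C : Clause N) (v : Register N) :
    inner ℂ C.checkVec v = (1 / 2 : ℂ) * ∑ j, sign (C.neg j) * v (C.var j) := by
  simp only [Clause.checkVec, inner_smul_left, sum_inner, inner_ket, star_sign]
  simp only [map_div₀, map_one, map_ofNat]

theorem Clause.norm_checkVec {N : ℕ} (C : Clause N) : ‖C.checkVec‖ = 1 := by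
  have h : inner ℂ C.checkVec C.checkVec = (1 : ℂ) := by
    rw [Clause.inner_checkVec]
    simp only [Clause.checkVec, PiLp.smul_apply, C.sum_smul_ket_apply, smul_eq_mul]
    simp only [mul_left_comm _ (1 / 2 : ℂ), sign_mul_self]
    norm_num
  rw [inner_self_eq_norm_sq_to_K] at h
  have h' : ‖C.checkVec‖ ^ 2 = 1 := by
    apply Complex.ofReal_injective
    simpa using h
  exact (pow_eq_one_iff_of_nonneg (norm_nonneg _) two_ne_zero).1 h'

theorem Clause.checkVec_mem_space {N : ℕ} (C : Clause N) : C.checkVec ∈ C.space :=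
  Submodule.smul_mem _ _ (Submodule.sum_mem _ fun j _ => Submodule.smul_mem _ _
    (Submodule.subset_span ⟨j, rfl⟩))

theorem Clause.sum_sign_mul_sign {N : ℕ} (C : Clause N) (x : Fin N → Bool) :
    ∑ j, sign (C.neg j) * sign (x (C.var j)) =
      4 - 2 * ((Finset.univ.filter fun j : Fin 4 => C.literal x j = true).card : ℂ) := by
  have h : ∀ j, sign (C.neg j) * sign (x (C.var j)) =
      1 - 2 * (if C.literal x j = true then 1 else 0) := by
    intro j
    unfold Clause.literal
    cases C.neg j <;> cases x (C.var j) <;> norm_num [sign]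
  rw [Finset.sum_congr rfl fun j _ => h j, Finset.sum_sub_distrib, ← Finset.mul_sum,
    Finset.sum_boole]
  simp

theorem Clause.checkVec_mem_orthogonal {N : ℕ} (C : Clause N) : C.checkVec ∈ C.acceptSpaceᗮ := by
  rw [Submodule.mem_orthogonal']
  intro u hu
  induction hu using Submodule.span_induction with
  | mem u hu =>
    obtain ⟨x, hx, rfl⟩ := hu
    have hx' : (Finset.univ.filter fun j : Fin 4 => C.literal x j = true).card = 2 := hx
    rw [Clause.reducedState, inner_smul_right, Clause.inner_checkVec]
    simp only [C.sum_smul_ket_apply fun j => sign (x (C.var j))]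
    rw [C.sum_sign_mul_sign, hx']
    norm_num
  | zero => simp
  | add a b _ _ ha hb => rw [inner_add_right, ha, hb, add_zero]
  | smul c a _ ha => rw [inner_smul_right, ha, mul_zero]

/-- The overlap is `2 - n`, with `n` the number of true literals: an integer, nonzero when the
clause is violated. -/
theorem Clause.one_le_norm_inner_checkVec {N : ℕ} (C : Clause N) (x : Fin N → Bool)
    (hx : ¬ C.Satisfied x) :
    1 ≤ ‖inner ℂ C.checkVec (∑ i, sign (x i) • ket i : Register N)‖ := by
  rw [Clause.inner_checkVec]
  simp only [sum_sign_apply]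
  rw [C.sum_sign_mul_sign]
  have hx' : (Finset.univ.filter fun j : Fin 4 => C.literal x j = true).card ≠ 2 := hx
  generalize (Finset.univ.filter fun j : Fin 4 => C.literal x j = true).card = n at hx'
  have h1 : (1 / 2 : ℂ) * (4 - 2 * (n : ℂ)) = (((2 - n : ℤ) : ℝ) : ℂ) := by push_cast; ring
  rw [h1, Complex.norm_real, Real.norm_eq_abs]
  have h2 : (1 : ℤ) ≤ |2 - (n : ℤ)| := Int.one_le_abs (by omega)
  exact_mod_cast h2

/-- The rejection probability on a clause is at least the weight on its check vector. -/
theorem Clause.norm_acceptSpace_add_le {N : ℕ} (C : Clause N) (v : Register N) :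
    ‖C.acceptSpace.starProjection (C.space.starProjection v)‖ ^ 2 +
      ‖inner ℂ C.checkVec v‖ ^ 2 ≤ ‖C.space.starProjection v‖ ^ 2 := by
  rw [Submodule.norm_sq_eq_add_norm_sq_starProjection (C.space.starProjection v) C.acceptSpace]
  have h : inner ℂ C.checkVec v =
      inner ℂ C.checkVec (C.acceptSpaceᗮ.starProjection (C.space.starProjection v)) := by
    rw [← Submodule.inner_starProjection_left_eq_right,
      Submodule.starProjection_eq_self_iff.2 C.checkVec_mem_orthogonal,
      ← Submodule.inner_starProjection_left_eq_right,
      Submodule.starProjection_eq_self_iff.2 C.checkVec_mem_space]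
  have h2 := norm_inner_le_norm (𝕜 := ℂ) C.checkVec
    (C.acceptSpaceᗮ.starProjection (C.space.starProjection v))
  rw [← h, C.norm_checkVec, one_mul] at h2
  have := pow_le_pow_left₀ (norm_nonneg _) h2 2
  linarith

section Block

variable {N M s : ℕ} {Φ : Instance N M} (B : BlockPartition Φ s)

open Classical in
theorem norm_sq_eq_block_sum (r : Fin s) (v : Register N) :
    ‖v‖ ^ 2 = ‖(⨆ C : {C : Fin M // B.block C = r}, (Φ C).space)ᗮ.starProjection v‖ ^ 2 +
      ∑ C ∈ Finset.univ.filter (fun C : Fin M => B.block C = r),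
        ‖(Φ C).space.starProjection v‖ ^ 2 := by
  rw [Finset.sum_subtype (p := fun C => B.block C = r) _ (by simp)]
  refine norm_sq_eq_orthogonal_add_sum (fun C : {C : Fin M // B.block C = r} => (Φ C).space)
    (fun C D hCD => ?_) v
  refine Submodule.isOrtho_span.2 ?_
  rintro _ ⟨i, rfl⟩ _ ⟨j, rfl⟩
  rw [inner_ket, ket_apply, if_neg]
  exact B.disjoint C D (fun h => hCD (Subtype.ext h)) (C.2.trans D.2.symm) i j

theorem blockAcceptProb_add_le (r : Fin s) (v : Register N) :
    blockAcceptProb B r v + ∑ C ∈ Finset.univ.filter (fun C : Fin M => B.block C = r),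
      ‖inner ℂ (Φ C).checkVec v‖ ^ 2 ≤ ‖v‖ ^ 2 := by
  classical
  rw [norm_sq_eq_block_sum B r v, blockAcceptProb, add_assoc, ← Finset.sum_add_distrib]
  refine add_le_add_right ?_ _
  convert Finset.sum_le_sum fun C (_ : C ∈ Finset.univ.filter fun C : Fin M => B.block C = r) =>
    (Φ C).norm_acceptSpace_add_le v

theorem blockAcceptProb_nonneg (r : Fin s) (v : Register N) : 0 ≤ blockAcceptProb B r v :=
  add_nonneg (by positivity) (Finset.sum_nonneg fun _ _ => by positivity)

theorem satTestProb_add_le (hs : 0 < s) (v : Register N) :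
    satTestProb B v + (∑ C, ‖inner ℂ (Φ C).checkVec v‖ ^ 2) / s ≤ ‖v‖ ^ 2 := by
  classical
  have hs' : (0 : ℝ) < s := by exact_mod_cast hs
  rw [satTestProb, ← add_div, div_le_iff₀ hs', ← Finset.sum_fiberwise Finset.univ B.block,
    ← Finset.sum_add_distrib]
  have := Finset.sum_le_sum fun r (_ : r ∈ Finset.univ) => blockAcceptProb_add_le B r v
  refine this.trans ?_
  simp [mul_comm]

/-- Bessel's inequality in each block, read off from the nonnegativity of the acceptance
probability. It controls the error when `v` is replaced by a nearby vector. -/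
theorem sum_inner_checkVec_le (B : BlockPartition Φ s) (v : Register N) :
    ∑ C, ‖inner ℂ (Φ C).checkVec v‖ ^ 2 ≤ s * ‖v‖ ^ 2 := by
  classical
  rw [← Finset.sum_fiberwise Finset.univ B.block]
  have := Finset.sum_le_sum fun r (_ : r ∈ Finset.univ) =>
    (le_add_of_nonneg_left (blockAcceptProb_nonneg B r v)).trans (blockAcceptProb_add_le B r v)
  refine this.trans ?_
  simp

theorem properState_eq {N : ℕ} (x : Fin N → Bool) (i : Fin N) :
    (properState x) i = ((1 / Real.sqrt N : ℝ) : ℂ) * sign (x i) := by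
  rw [properState, PiLp.smul_apply, sum_sign_apply, smul_eq_mul]

theorem norm_properState {N : ℕ} (hN : 0 < N) (x : Fin N → Bool) : ‖properState x‖ = 1 := by
  have hN' : (0 : ℝ) < N := by exact_mod_cast hN
  rw [EuclideanSpace.norm_eq, Real.sqrt_eq_one]
  simp only [properState_eq, norm_mul, norm_sign, mul_one, Complex.norm_real, norm_div, norm_one,
    Real.norm_eq_abs, abs_of_nonneg (Real.sqrt_nonneg _), div_pow, Real.sq_sqrt hN'.le, one_pow]
  simp [hN'.ne']

theorem Clause.starProjection_properState {N : ℕ} (C : Clause N) (x : Fin N → Bool) :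
    C.space.starProjection (properState x) =
      ((1 / Real.sqrt N : ℝ) : ℂ) • (2 : ℂ) • C.reducedState x := by
  refine Submodule.eq_starProjection_of_mem_orthogonal ?_ ?_
  · exact Submodule.smul_mem _ _ (Submodule.smul_mem _ _ (Submodule.smul_mem _ _
      (Submodule.sum_mem _ fun j _ => Submodule.smul_mem _ _ (Submodule.subset_span ⟨j, rfl⟩))))
  · refine C.mem_space_orthogonal _ fun j => ?_
    simp only [PiLp.sub_apply, PiLp.smul_apply, properState_eq, Clause.reducedState,
      C.sum_smul_ket_apply fun j => sign (x (C.var j)), smul_eq_mul]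
    ring

theorem satTestProb_properState (hN : 0 < N) (hs : 0 < s) (x : Fin N → Bool)
    (hx : SatisfiedBy Φ x) : satTestProb B (properState x) = 1 := by
  classical
  have h : ∀ r, blockAcceptProb B r (properState x) = 1 := by
    intro r
    rw [← one_pow 2, ← norm_properState hN x, norm_sq_eq_block_sum B r, blockAcceptProb]
    congr 1
    refine Finset.sum_congr (by congr) fun C _ => ?_
    have hC : (Φ C).space.starProjection (properState x) ∈ (Φ C).acceptSpace := by
      rw [Clause.starProjection_properState]
      exact Submodule.smul_mem _ _ (Submodule.smul_mem _ _ (Submodule.subset_span ⟨x, hx C, rfl⟩))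
    rw [Submodule.starProjection_eq_self_iff.2 hC]
  have hs' : (s : ℝ) ≠ 0 := by exact_mod_cast hs.ne'
  simp [satTestProb, h, hs']

/-- The Satisfiability Test rejects states close to a multiple of a proper state that violates
many clauses. -/
theorem satTestProb_le_of_near (hs : 0 < s) (v : Register N) (hv : ‖v‖ = 1) (β : ℂ)
    (x : Fin N → Bool) {η : ℝ} (hη : ‖v - β • ∑ i, sign (x i) • ket i‖ ^ 2 ≤ η) :
    satTestProb B v ≤ 1 - (‖β‖ ^ 2 * numViolated Φ x / 2 - s * η) / s := by
  classical
  set u : Register N := ∑ i, sign (x i) • ket i with hu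
  have hs' : (0 : ℝ) < s := by exact_mod_cast hs
  have h1 := satTestProb_add_le B hs v
  have h2 := sum_inner_checkVec_le B (v - β • u)
  have h3 : ‖β‖ ^ 2 * numViolated Φ x ≤ ∑ C, ‖inner ℂ (Φ C).checkVec (β • u)‖ ^ 2 := by
    have : (numViolated Φ x : ℝ) = ∑ C : Fin M, if ¬ (Φ C).Satisfied x then (1 : ℝ) else 0 := by
      rw [Finset.sum_boole]; rfl
    rw [this, Finset.mul_sum]
    refine Finset.sum_le_sum fun C _ => ?_
    rw [inner_smul_right, norm_mul, mul_pow]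
    refine mul_le_mul_of_nonneg_left ?_ (by positivity)
    split_ifs with hC
    · positivity
    · exact one_le_pow₀ ((Φ C).one_le_norm_inner_checkVec x hC)
  -- `‖b‖² ≤ 2‖a‖² + 2‖a - b‖²`, which moves the overlaps of `β • u` over to `v`.
  have h4 : ∑ C, ‖inner ℂ (Φ C).checkVec (β • u)‖ ^ 2 ≤
      2 * ∑ C, ‖inner ℂ (Φ C).checkVec v‖ ^ 2 +
        2 * ∑ C, ‖inner ℂ (Φ C).checkVec (v - β • u)‖ ^ 2 := by
    rw [Finset.mul_sum, Finset.mul_sum, ← Finset.sum_add_distrib]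
    refine Finset.sum_le_sum fun C _ => ?_
    rw [inner_sub_right]
    set a := inner ℂ (Φ C).checkVec v
    set b := inner ℂ (Φ C).checkVec (β • u)
    have h5 : ‖b‖ ≤ ‖a‖ + ‖a - b‖ := by
      have := norm_sub_le a (a - b)
      rwa [sub_sub_cancel] at this
    nlinarith [norm_nonneg b, norm_nonneg a, norm_nonneg (a - b), sq_nonneg (‖a‖ - ‖a - b‖)]
  have h6 : ‖β‖ ^ 2 * numViolated Φ x / 2 - s * η ≤ ∑ C, ‖inner ℂ (Φ C).checkVec v‖ ^ 2 := by
    have := mul_le_mul_of_nonneg_left hη hs'.le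
    linarith
  have h7 := div_le_div_of_nonneg_right h6 hs'.le
  rw [hv] at h1
  linarith

theorem satTestProb_le_one (hs : 0 < s) (v : Register N) (hv : ‖v‖ = 1) : satTestProb B v ≤ 1 := by
  have h1 := satTestProb_add_le B hs v
  rw [hv, one_pow] at h1
  have : 0 ≤ (∑ C, ‖inner ℂ (Φ C).checkVec v‖ ^ 2) / s := by positivity
  linarith

end Block

/-! ### The Uniformity Test -/

section Uniformity

variable {N : ℕ}

/-- Half the squared distance of the amplitude `v j` from `± v i`, the nearer sign. -/
def pairGap (v : Register N) (i j : Fin N) : ℝ := min (‖v i + v j‖ ^ 2) (‖v i - v j‖ ^ 2) / 2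

theorem pairGap_nonneg (v : Register N) (i j : Fin N) : 0 ≤ pairGap v i j :=
  div_nonneg (le_min (by positivity) (by positivity)) zero_le_two

theorem pairGap_comm (v : Register N) (i j : Fin N) : pairGap v i j = pairGap v j i := by
  rw [pairGap, pairGap, add_comm, norm_sub_rev]

theorem pairGap_self (v : Register N) (i : Fin N) : pairGap v i i = 0 := by
  simp [pairGap]

namespace Matching

variable (m : Matching N)

/-- The probability of an outcome. -/
def outcomeProb (v : Register N) (o : m.Outcome) : ℝ := ‖inner ℂ (m.basisVec o) v‖ ^ 2

/-- The outcome on the same edge with the other sign. -/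
def flip (o : m.Outcome) : m.Outcome := (o.1, !o.2)

theorem flip_flip (o : m.Outcome) : m.flip (m.flip o) = o := by simp [flip]

theorem outcomeProb_nonneg (v : Register N) (o : m.Outcome) : 0 ≤ m.outcomeProb v o := by
  unfold outcomeProb; positivity

theorem outcomeProb_eq (v : Register N) (o : m.Outcome) :
    m.outcomeProb v o = ‖v o.1.1 + sign o.2 * v (m.1 o.1.1)‖ ^ 2 / 2 := by
  rw [outcomeProb, basisVec, inner_smul_left, inner_add_left, inner_smul_left, inner_ket, inner_ket,
    star_sign, norm_mul, mul_pow, RCLike.norm_conj, Complex.norm_real, Real.norm_eq_abs, sq_abs,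
    div_pow, Real.sq_sqrt zero_le_two]
  ring

theorem sum_outcomeProb (v : Register N) : ∑ o, m.outcomeProb v o = ‖v‖ ^ 2 := by
  rw [EuclideanSpace.norm_sq_eq, ← m.sum_edge, Fintype.sum_prod_type]
  refine Finset.sum_congr rfl fun e _ => ?_
  rw [Fintype.sum_bool, outcomeProb_eq, outcomeProb_eq]
  have := parallelogram_law_with_norm ℂ (v e.1) (v (m.1 e.1))
  simp only [sign, if_true, Bool.false_eq_true, if_false, one_mul, neg_mul, ← sub_eq_add_neg]
  linarith

theorem pairGap_le_outcomeProb (v : Register N) (o : m.Outcome) :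
    pairGap v o.1.1 (m.1 o.1.1) ≤ m.outcomeProb v o := by
  rw [outcomeProb_eq, pairGap]
  refine div_le_div_of_nonneg_right ?_ zero_le_two
  cases o.2
  · simp [sign]
  · simp [sign, ← sub_eq_add_neg]

theorem sum_pairGap_outcome (v : Register N) :
    ∑ o : m.Outcome, pairGap v o.1.1 (m.1 o.1.1) = ∑ i, pairGap v i (m.1 i) := by
  rw [← m.sum_edge, Fintype.sum_prod_type]
  refine Finset.sum_congr rfl fun e _ => ?_
  rw [Fintype.sum_bool, m.2.1, pairGap_comm v (m.1 e.1)]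

theorem sum_pairGap_le_one (v : Register N) (hv : ‖v‖ = 1) : ∑ i, pairGap v i (m.1 i) ≤ 1 := by
  rw [← sum_pairGap_outcome, ← one_pow 2, ← hv, ← m.sum_outcomeProb]
  exact Finset.sum_le_sum fun o _ => m.pairGap_le_outcomeProb v o

/-- A matching has `N / 2` edges with two outcomes each, hence `N` outcomes. -/
theorem sum_outcome_const (c : ℝ) : ∑ _o : m.Outcome, c = N * c := by
  have := m.sum_edge fun _ => c
  rw [Fintype.sum_prod_type]
  simpa [two_mul, mul_add] using this

open Classical in
theorem acceptProb_le_avoidProb (K : ℕ) (v : Register N) :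
    m.acceptProb (fun _ : Fin K => v) ≤ avoidProb (m.outcomeProb v) m.flip K ∅ := by
  refine le_trans ?_ (sum_noCollision_le_avoidProb (m.outcomeProb_nonneg v) m.flip K ∅)
  refine Finset.sum_le_sum_of_subset_of_nonneg (fun o ho => ?_)
    (fun o _ _ => Finset.prod_nonneg fun k _ => m.outcomeProb_nonneg v _)
  rw [Finset.mem_filter] at ho ⊢
  refine ⟨ho.1, by simp, fun k l h => ho.2 ⟨k, l, ?_, ?_⟩⟩
  · rw [← h]; rfl
  · rw [← h]; simp [flip]

theorem acceptProb_le_one (K : ℕ) (v : Register N) (hv : ‖v‖ = 1) :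
    m.acceptProb (fun _ : Fin K => v) ≤ 1 := by
  classical
  refine (m.acceptProb_le_avoidProb K v).trans ?_
  have hp1 : ∑ o, m.outcomeProb v o = 1 := by rw [m.sum_outcomeProb, hv, one_pow]
  have := avoidProb_le_pow (q := fun _ => 0) (m.outcomeProb_nonneg v) hp1 m.flip_flip
    (fun _ => le_rfl) (fun o => m.outcomeProb_nonneg v _) K ∅
  simpa using this

/-- Take as `G` the outcomes of gap at least `μ / (2 * N)`. The others, at most `N` in number, carry
at most `μ / 2`, so `G` keeps at least half of `μ`. -/
theorem acceptProb_le {v : Register N} (hv : ‖v‖ = 1) {μ : ℝ} (hμ : 0 ≤ μ) (hN : 0 < N)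
    (h : μ ≤ ∑ i, pairGap v i (m.1 i)) (n j : ℕ) :
    m.acceptProb (fun _ : Fin (n + j) => v) ≤ Real.exp (-(n * (μ / 4))) +
      (1 - (1 - Real.exp (-(n * (μ / (2 * N))))) * (μ / 4)) ^ j := by
  classical
  refine (m.acceptProb_le_avoidProb (n + j) v).trans ?_
  have hN' : (0 : ℝ) < N := by exact_mod_cast hN
  have hp1 : ∑ o, m.outcomeProb v o = 1 := by rw [m.sum_outcomeProb, hv, one_pow]
  set q : m.Outcome → ℝ := fun o => pairGap v o.1.1 (m.1 o.1.1) with hq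
  set G := Finset.univ.filter fun o => μ / (2 * N) ≤ q o with hG
  have hlight : ∑ o ∈ Finset.univ.filter (fun o => ¬ μ / (2 * N) ≤ q o), q o ≤ μ / 2 := by
    calc ∑ o ∈ Finset.univ.filter (fun o => ¬ μ / (2 * N) ≤ q o), q o
        ≤ ∑ o ∈ Finset.univ.filter (fun o => ¬ μ / (2 * N) ≤ q o), μ / (2 * N) :=
          Finset.sum_le_sum fun o ho => (not_le.1 (Finset.mem_filter.1 ho).2).le
      _ ≤ ∑ _o : m.Outcome, μ / (2 * N) :=
          Finset.sum_le_univ_sum_of_nonneg fun _ => by positivity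
      _ = μ / 2 := by rw [sum_outcome_const]; field_simp
  have hsum : ∑ o ∈ G, q o + ∑ o ∈ Finset.univ.filter (fun o => ¬ μ / (2 * N) ≤ q o), q o =
      ∑ i, pairGap v i (m.1 i) := by
    rw [hG, Finset.sum_filter_add_sum_filter_not, hq, sum_pairGap_outcome]
  have := avoidProb_add_le (m.outcomeProb_nonneg v) hp1 m.flip_flip
    (fun o => pairGap_nonneg v _ _) (m.pairGap_le_outcomeProb v)
    (fun o => m.pairGap_le_outcomeProb v (m.flip o)) hμ (c := μ / (2 * N)) (by positivity) G
    (fun o ho => (Finset.mem_filter.1 ho).2) (by linarith) n j ∅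
  simpa using this

theorem acceptProb_properState (K : ℕ) (hN : 0 < N) (x : Fin N → Bool) :
    m.acceptProb (fun _ : Fin K => properState x) = 1 := by
  classical
  have hp1 : ∑ o, m.outcomeProb (properState x) o = 1 := by
    rw [m.sum_outcomeProb, norm_properState hN, one_pow]
  -- Two amplitudes equal up to sign cancel in either their sum or their difference.
  have hzero : ∀ o, m.outcomeProb (properState x) o = 0 ∨
      m.outcomeProb (properState x) (m.flip o) = 0 := by
    rintro ⟨e, b⟩
    simp only [outcomeProb_eq, properState_eq, flip]
    cases b <;> cases x e.1 <;> cases x (m.1 e.1) <;> simp [sign]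
  calc m.acceptProb (fun _ : Fin K => properState x)
      = ∑ o : Fin K → m.Outcome, ∏ k, m.outcomeProb (properState x) (o k) := by
        rw [acceptProb]
        refine Finset.sum_subset (Finset.filter_subset _ _) fun o _ ho => ?_
        have hd : m.Disagreement o := by
          by_contra hd
          exact ho (Finset.mem_filter.2 ⟨Finset.mem_univ _, hd⟩)
        obtain ⟨k, l, h1, h2⟩ := hd
        have hl : o l = m.flip (o k) := by
          refine Prod.ext h1.symm ?_
          revert h2
          cases hk : (o k).2 <;> cases hl : (o l).2 <;> simp [flip, hk]
        rcases hzero (o k) with h | h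
        · exact Finset.prod_eq_zero (Finset.mem_univ k) h
        · exact Finset.prod_eq_zero (Finset.mem_univ l) (by rw [← hl] at h; exact h)
    _ = (∑ o, m.outcomeProb (properState x) o) ^ K := (Fintype.sum_pow _ _).symm
    _ = 1 := by rw [hp1, one_pow]

end Matching

theorem uniformityTestProb_properState (K : ℕ) (hN : 0 < N) (hE : Even N) (x : Fin N → Bool) :
    uniformityTestProb (fun _ : Fin K => properState x) = 1 := by
  have := Matching.nonempty_of_even hE
  have h : (Fintype.card (Matching N) : ℝ) ≠ 0 := by exact_mod_cast Fintype.card_ne_zero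
  rw [uniformityTestProb, Finset.sum_congr rfl fun m _ => Matching.acceptProb_properState m K hN x]
  simp [h]

theorem uniformityTestProb_le_one (K : ℕ) (hE : Even N) (v : Register N) (hv : ‖v‖ = 1) :
    uniformityTestProb (fun _ : Fin K => v) ≤ 1 := by
  have := Matching.nonempty_of_even hE
  have h : (0 : ℝ) < Fintype.card (Matching N) := by exact_mod_cast Fintype.card_pos
  rw [uniformityTestProb, div_le_one h]
  refine (Finset.sum_le_sum fun m _ => Matching.acceptProb_le_one m K v hv).trans ?_
  simp

theorem uniformityTestProb_le_of_sum (hE : Even N) {K : ℕ} {v : Register N} (hv : ‖v‖ = 1)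
    {μ δ : ℝ} (hδ : 0 ≤ δ) (hμ : 0 ≤ μ)
    (hacc : ∀ m : Matching N, μ ≤ ∑ i, pairGap v i (m.1 i) →
      m.acceptProb (fun _ : Fin K => v) ≤ 1 - δ)
    (h : 2 * μ * Fintype.card (Matching N) ≤ ∑ m : Matching N, ∑ i, pairGap v i (m.1 i)) :
    uniformityTestProb (fun _ : Fin K => v) ≤ 1 - δ * μ := by
  have := Matching.nonempty_of_even hE
  have hc : (0 : ℝ) < Fintype.card (Matching N) := by exact_mod_cast Fintype.card_pos
  rw [uniformityTestProb, div_le_iff₀ hc]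
  -- A linear form of the reverse Markov inequality: gap sums are at most 1, so this affine bound is
  -- valid on both sides of the threshold `μ`, and averaging it finishes.
  have hm : ∀ m ∈ (Finset.univ : Finset (Matching N)), m.acceptProb (fun _ : Fin K => v) ≤
      1 - δ * (∑ i, pairGap v i (m.1 i) - μ) := by
    intro m _
    have h1 := m.sum_pairGap_le_one v hv
    by_cases hD : μ ≤ ∑ i, pairGap v i (m.1 i)
    · have := hacc m hD
      nlinarith
    · have := m.acceptProb_le_one K v hv
      nlinarith
  refine (Finset.sum_le_sum hm).trans ?_
  rw [Finset.sum_sub_distrib, ← Finset.mul_sum, Finset.sum_sub_distrib]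
  simp only [Finset.sum_const, Finset.card_univ, nsmul_eq_mul, mul_one]
  nlinarith

theorem exists_sum_pairGap_le (hN : 0 < N) (hE : Even N) (v : Register N) {μ : ℝ}
    (h : ∑ m : Matching N, ∑ i, pairGap v i (m.1 i) ≤ 2 * μ * Fintype.card (Matching N)) :
    ∃ i, ∑ j, pairGap v i j ≤ 2 * μ := by
  have := Matching.nonempty_of_even hE
  have hc : (0 : ℝ) < Fintype.card (Matching N) := by exact_mod_cast Fintype.card_pos
  have h1 : (Fintype.card (Matching N) : ℝ) * ∑ i, ∑ j, pairGap v i j ≤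
      N * ∑ m : Matching N, ∑ i, pairGap v i (m.1 i) := by
    rw [Finset.mul_sum, Finset.sum_comm, Finset.mul_sum]
    exact Finset.sum_le_sum fun i _ =>
      Matching.sum_partner i (pairGap v i) (pairGap_nonneg v i) (pairGap_self v i)
  have h2 : ∑ i, ∑ j, pairGap v i j ≤ ∑ _i : Fin N, 2 * μ := by
    rw [Finset.sum_const, Finset.card_univ, Fintype.card_fin, nsmul_eq_mul]
    refine le_of_mul_le_mul_left ?_ hc
    nlinarith [mul_le_mul_of_nonneg_left h (Nat.cast_nonneg (α := ℝ) N)]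
  have : Nonempty (Fin N) := ⟨⟨0, hN⟩⟩
  obtain ⟨i, -, hi⟩ := Finset.exists_le_of_sum_le Finset.univ_nonempty h2
  exact ⟨i, hi⟩

/-- Rounding all amplitudes to `± v i`. -/
theorem exists_signs_near (v : Register N) (i : Fin N) :
    ∃ x : Fin N → Bool, ‖v - v i • ∑ j, sign (x j) • ket j‖ ^ 2 = 2 * ∑ j, pairGap v i j := by
  classical
  refine ⟨fun j => decide (‖v i + v j‖ ^ 2 ≤ ‖v i - v j‖ ^ 2), ?_⟩
  rw [EuclideanSpace.norm_sq_eq, Finset.mul_sum]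
  refine Finset.sum_congr rfl fun j _ => ?_
  rw [PiLp.sub_apply, PiLp.smul_apply, sum_sign_apply, smul_eq_mul, pairGap]
  by_cases h : ‖v i + v j‖ ^ 2 ≤ ‖v i - v j‖ ^ 2
  · rw [min_eq_left h, decide_eq_true h]
    simp [sign, add_comm (v j)]
    ring
  · rw [min_eq_right (not_le.1 h).le, decide_eq_false h, ← norm_sub_rev]
    simp [sign]
    ring

theorem norm_sum_sign_sq (x : Fin N → Bool) : ‖(∑ j, sign (x j) • ket j : Register N)‖ ^ 2 = N := by
  rw [EuclideanSpace.norm_sq_eq]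
  simp [sum_sign_apply, norm_sign]

end Uniformity

/-! ### Soundness -/

theorem exists_soundness_gap (s : ℕ) (ε a κ : ℝ) (hε : 0 < ε) (ha : 0 < a) (hκ : 0 < κ) :
    ∃ δ : ℝ, 0 < δ ∧ ∃ N₀ : ℕ, ∀ (N M K : ℕ) (Φ : Instance N M) (B : BlockPartition Φ s)
      (k : Fin K) (v : Register N), N₀ ≤ N → Even N → (N : ℝ) ≤ a * (M : ℝ) →
      κ * Real.sqrt (N : ℝ) ≤ (K : ℝ) → HasGap Φ ε → ¬ Satisfiable Φ → ‖v‖ = 1 →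
        protocolProb B k (fun _ => v) ≤ 1 - δ := by
  rcases Nat.eq_zero_or_pos s with rfl | hs
  -- Without blocks there are no clauses, so `N ≤ a * M` forces `N = 0`, excluded by `N₀ = 1`.
  · refine ⟨1, one_pos, 1, fun N M K Φ B k v hN _ hNM _ _ _ _ => ?_⟩
    exfalso
    have hM : M = 0 := by
      by_contra hM
      exact (B.block ⟨0, Nat.pos_of_ne_zero hM⟩).elim0
    subst hM
    have : (1 : ℝ) ≤ N := by exact_mod_cast hN
    simp at hNM
    rw [hNM] at hN
    omega
  have hs' : (0 : ℝ) < s := by exact_mod_cast hs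
  -- The rounding error will be `4 * μ`: the first bound makes the distance at most `1 / 2`, the
  -- second keeps the loss `s * (4 * μ)` below half of the main term `ε / (8 * a)`.
  set μ := min (1 / 16) (ε / (64 * a * s)) with hμdef
  have hμ : 0 < μ := lt_min (by norm_num) (by positivity)
  have hμ1 : μ ≤ 1 / 16 := min_le_left _ _
  have hμ2 : μ ≤ ε / (64 * a * s) := min_le_right _ _
  obtain ⟨δ, hδ, N₀, hN₀⟩ := exists_collision_bound μ κ hμ hκ
  refine ⟨min (δ * μ / 2) (ε / (32 * a * s)), lt_min (by positivity) (by positivity),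
    max N₀ 1, fun N M K Φ B k v hN hE hNM hK hgap hunsat hv => ?_⟩
  have hNpos : 0 < N := (le_max_right _ _).trans hN
  have hNpos' : (0 : ℝ) < N := by exact_mod_cast hNpos
  obtain ⟨n, j, rfl, hnj⟩ := hN₀ N K ((le_max_left _ _).trans hN) hK (by linarith)
  have hsat1 := satTestProb_le_one B hs v hv
  have huni1 := uniformityTestProb_le_one (n + j) hE v hv
  rw [protocolProb]
  by_cases h : 2 * μ * Fintype.card (Matching N) ≤
      ∑ m : Matching N, ∑ i, pairGap v i (m.1 i)
  · have huni := uniformityTestProb_le_of_sum hE hv hδ.le hμ.le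
      (fun m hm => (m.acceptProb_le hv hμ.le hNpos hm n j).trans hnj) h
    have := min_le_left (δ * μ / 2) (ε / (32 * a * s))
    linarith
  · obtain ⟨i, hi⟩ := exists_sum_pairGap_le hNpos hE v (not_le.1 h).le
    obtain ⟨x, hx⟩ := exists_signs_near v i
    have hη : ‖v - v i • ∑ j, sign (x j) • ket j‖ ^ 2 ≤ 4 * μ := by linarith
    have hsat := satTestProb_le_of_near B hs v hv (v i) x hη
    set u : Register N := ∑ j, sign (x j) • ket j with hu
    -- A unit vector within `1 / 2` of `v i • u` forces `‖v i • u‖ ≥ 1 / 2`, and `‖u‖ ^ 2 = N`.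
    have hβ : 1 / 4 ≤ ‖v i‖ ^ 2 * N := by
      rw [← norm_sum_sign_sq x, ← mul_pow, ← norm_smul]
      have h1 : ‖v - v i • u‖ ≤ 1 / 2 :=
        (sq_le_sq₀ (norm_nonneg _) (by norm_num)).1 (by norm_num; linarith)
      have h2 := norm_le_norm_add_norm_sub' v (v i • u)
      rw [hv] at h2
      nlinarith
    have hviol : ε * M ≤ numViolated Φ x := (hgap.resolve_left hunsat) x
    have hprod : ε / (4 * a) ≤ ‖v i‖ ^ 2 * numViolated Φ x := by
      calc ε / (4 * a) = ε / a * (1 / 4) := by field_simp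
        _ ≤ ε / a * (‖v i‖ ^ 2 * N) := by gcongr
        _ ≤ ε / a * (‖v i‖ ^ 2 * (a * M)) := by gcongr
        _ = ‖v i‖ ^ 2 * (ε * M) := by field_simp
        _ ≤ ‖v i‖ ^ 2 * numViolated Φ x := by gcongr
    have hsμ : s * (4 * μ) ≤ ε / (16 * a) := by
      calc s * (4 * μ) ≤ s * (4 * (ε / (64 * a * s))) := by gcongr
        _ = ε / (16 * a) := by field_simp; norm_num
    have hfin : ε / (16 * a * s) ≤ (‖v i‖ ^ 2 * numViolated Φ x / 2 - s * (4 * μ)) / s := by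
      rw [← div_div]
      refine div_le_div_of_nonneg_right ?_ hs'.le
      have : ε / (16 * a) = ε / (4 * a) / 2 - ε / (16 * a) := by field_simp; norm_num
      linarith
    have hhalf : ε / (32 * a * s) = ε / (16 * a * s) / 2 := by field_simp; norm_num
    have := min_le_right (δ * μ / 2) (ε / (32 * a * s))
    linarith

end TwoOutOfFour

end

theorem mainTheorem9 :
    -- the block partition used by the protocol exists, with a constant number of blocks
    (∀ (c N M : ℕ) (Φ : TwoOutOfFour.Instance N M), TwoOutOfFour.IsBalanced Φ c →
      Nonempty (TwoOutOfFour.BlockPartition Φ (4 * c + 1))) ∧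
    -- perfect completeness
    (∀ (N M s K : ℕ) (Φ : TwoOutOfFour.Instance N M) (B : TwoOutOfFour.BlockPartition Φ s)
      (k : Fin K) (x : Fin N → Bool), 0 < N → Even N → 0 < s →
      TwoOutOfFour.SatisfiedBy Φ x →
        ‖TwoOutOfFour.properState x‖ = 1 ∧
        TwoOutOfFour.protocolProb B k (fun _ => TwoOutOfFour.properState x) = 1) ∧
    -- constant soundness
    (∀ (s : ℕ) (ε a κ : ℝ), 0 < ε → 0 < a → 0 < κ →
      ∃ δ : ℝ, 0 < δ ∧ ∃ N₀ : ℕ, ∀ (N M K : ℕ) (Φ : TwoOutOfFour.Instance N M)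
        (B : TwoOutOfFour.BlockPartition Φ s) (k : Fin K) (v : TwoOutOfFour.Register N),
        N₀ ≤ N → Even N → (N : ℝ) ≤ a * (M : ℝ) → κ * Real.sqrt (N : ℝ) ≤ (K : ℝ) →
        TwoOutOfFour.HasGap Φ ε → ¬ TwoOutOfFour.Satisfiable Φ → ‖v‖ = 1 →
          TwoOutOfFour.protocolProb B k (fun _ => v) ≤ 1 - δ) := by
  refine ⟨fun c N M Φ h => TwoOutOfFour.exists_blockPartition Φ h,
    fun N M s K Φ B k x hN hE hs hx => ⟨TwoOutOfFour.norm_properState hN x, ?_⟩,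
    fun s ε a κ hε ha hκ => TwoOutOfFour.exists_soundness_gap s ε a κ hε ha hκ⟩
  rw [TwoOutOfFour.protocolProb, TwoOutOfFour.satTestProb_properState B hN hs x hx,
    TwoOutOfFour.uniformityTestProb_properState K hN hE x]
  norm_num
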